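/- Let $A$ be an idiom, i.e. a complete modular lattice with $a\wedge\bigvee X=\bigvee\{a\wedge x\mid x\in X\}$ for all $a\in A$ and all directed $X\subseteq A$. An interval of $A$ is a set $[a,b]=\{x\mid a\le x\le b\}$ with $a\le b$; $\mathcal O$ denotes the set of trivial intervals $[a,a]$. Two intervals are similar if one is $[l,l\vee r]$ and the other is $[l\wedge r,r]$ for some $l,r\in A$. A division set is a non-empty set $\mathcal D$ of intervals that is closed under similarity, under subintervals and under abutting intervals ($[a,b],[b,c]\in\mathcal D\Rightarrow[a,c]\in\mathcal D$), and such that $[a,\bigvee X]\in\mathcal D$ whenever $X\neq\emptyset$ and $[a,x]\in\mathcal D$ for all $x\in X$. $\mathcal Dvs(\mathcal B)$ denotes the least division set containing $\mathcal B$. A nucleus on $A$ is a map $j\colon A\to A$ with $x\le j(x)=j(j(x))$ and $j(x\wedge y)=j(x)\wedge j(y)$. The nuclei form a frame under the pointwise order, with least element $\mathrm{id}$; $\neg j$ denotes the negation of $j$ in it, i.e. the largest nucleus $k$ with $k\wedge j=\mathrm{id}$. Put $\mathcal D_j=\{[a,b]\mid b\le j(a)\}$. The nucleus $j$ is spectral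 if the lattice $A_j=\{x\mid j(x)=x\}$ is complemented. Let $\mathcal B$ be a set of intervals. An interval $[a,b]$ is * simple if there is no $x$ with $a<x<b$; * complemented (in $\mathcal Cmp$) if every $x\in[a,b]$ has some $y\in[a,b]$ with $x\wedge y=a$ and $x\vee y=b$; * $\mathcal B$-full (in $\mathcal Fll(\mathcal B)$) if every $x\in[a,b]$ has some $y\in[a,b]$ with $x\wedge y=a$ and $[x\vee y,b]\in\mathcal B$; * $\mathcal B$-critical (in $\mathcal Crt(\mathcal B)$) if for every $x\in[a,b]$ either $x=a$ or $[x,b]\in\mathcal B$; * $j$-semicritical if $b=\bigvee X$ for some $X\subseteq[a,b]$ with $[a,x]\in\mathcal Crt(\mathcal D_j)$ for all $x\in X$; * semi-simple if $b=\bigvee X$ for some $X\subseteq[a,b]$ with $[a,x]$ simple for all $x\in X$; * weakly atomic if for all $a\le c<d\le b$ there are $c\le x<y\le d$ with $[x,y]$ simple. Put $\mathcal Boy(\mathcal B)=\mathcal Dvs(\mathcal Fll(\mathcal B))$, and write $soc_j(a)$, $cbd_j(a)$, $cbd(a)$ for the supremum of all $x\ge a$ such that $[a,x]$ lies in $\mathcal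 Crt(\mathcal D_j)$, $\mathcal Fll(\mathcal D_j)$, $\mathcal Cmp$, respectively. For an inflator $d$ on $A$ let $d^\infty$ be the eventual value of its transfinite iterates ($d^0=\mathrm{id}$, $d^{\alpha+1}=d\circ d^\alpha$, pointwise suprema at limit ordinals). **Theorem.** Let $j$ be a spectral nucleus on $A$. Then $\mathcal D_{\neg j}=\neg\mathcal D_j$, i.e. $\mathcal D_{\neg j}$ is the greatest division set $\mathcal E$ with $\mathcal E\cap\mathcal D_j\subseteq\mathcal O$, and: 1. For every $[a,b]\in\mathcal D_{\neg j}$, the interval $[a,b]$ is complemented, and there is $y\in[a,b]$ such that $y\wedge(b\wedge soc_j^\infty(a))=a$, $y\vee(b\wedge soc_j^\infty(a))=b$ and $[y,b]$ is $j$-semicritical. 2. $\mathcal Boy(\mathcal D_{\neg j})=\mathcal Dvs(\mathcal Cmp)$, and $cbd_{\neg j}^\infty=cbd^\infty$. 3. Every weakly atomic interval in $\mathcal D_{\neg j}$ is semi-simple. 4. If $A$ is compactly generated, then every interval in $\mathcal D_{\neg j}$ is semi-simple. -/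

import Mathlib

universe u

namespace IdiomTheory

/-- An idiom: a complete, modular, upper-continuous lattice. -/
class Idiom (A : Type u) [CompleteLattice A] : Prop extends IsModularLattice A where
  inf_sSup_of_directedOn (a : A) (X : Set A) (hX : DirectedOn (· ≤ ·) X) :
    a ⊓ sSup X = ⨆ x ∈ X, a ⊓ x

section Intervals

variable {A : Type u} [CompleteLattice A]

/-- All intervals of `A`; the interval `[a, b]` (with `a ≤ b`) is encoded by the pair `(a, b)`. -/
def allIntervals (A : Type u) [CompleteLattice A] : Set (A × A) := {I | I.1 ≤ I.2}

/-- The set `O` of trivial intervals `[a, a]`. -/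
def trivialIntervals (A : Type u) [CompleteLattice A] : Set (A × A) := {I | I.1 = I.2}

/-- Similarity: one of the intervals is `[l, l ⊔ r]` and the other one is `[l ⊓ r, r]`. -/
def Similar (J I : A × A) : Prop :=
  ∃ l r : A, (J = (l, l ⊔ r) ∧ I = (l ⊓ r, r)) ∨ (J = (l ⊓ r, r) ∧ I = (l, l ⊔ r))

/-- Abstract sets of intervals: non-empty and closed under similarity. -/
structure IsAbstract (B : Set (A × A)) : Prop where
  subset_all : B ⊆ allIntervals A
  nonempty : B.Nonempty
  similar : ∀ I J : A × A, Similar J I → I ∈ B → J ∈ B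

/-- Basic sets: abstract and closed under subintervals. -/
structure IsBasic (B : Set (A × A)) : Prop extends IsAbstract B where
  subinterval : ∀ a' a b b' : A, a' ≤ a → a ≤ b → b ≤ b' → (a', b') ∈ B → (a, b) ∈ B

/-- Congruence sets: basic and closed under abutting intervals. -/
structure IsCongruence (B : Set (A × A)) : Prop extends IsBasic B where
  abut : ∀ a b c : A, (a, b) ∈ B → (b, c) ∈ B → (a, c) ∈ B

/-- Division sets: congruence sets with the pre-division property.  For `X = ∅` the supremum,
computed in `[a, 1]`, would be `a`, and `(a, a)` is in every basic set. -/
structure IsDivision (B : Set (A × A)) : Prop extends IsCongruence B where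
  sSup_mem : ∀ (a : A) (X : Set A), X.Nonempty → (∀ x ∈ X, (a, x) ∈ B) → (a, sSup X) ∈ B

/-- `Dvs B`: the least division set that contains `B`. -/
def Dvs (B : Set (A × A)) : Set (A × A) := {I | ∀ E : Set (A × A), IsDivision E → B ⊆ E → I ∈ E}

/-- Simple intervals (the trivial ones included). -/
def Smp (A : Type u) [CompleteLattice A] : Set (A × A) :=
  {I | I.1 ≤ I.2 ∧ ¬ ∃ x : A, I.1 < x ∧ x < I.2}

/-- Complemented intervals. -/
def Cmp (A : Type u) [CompleteLattice A] : Set (A × A) :=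
  {I | I.1 ≤ I.2 ∧ ∀ x : A, I.1 ≤ x → x ≤ I.2 →
    ∃ y : A, I.1 ≤ y ∧ y ≤ I.2 ∧ x ⊓ y = I.1 ∧ x ⊔ y = I.2}

/-- `B`-full intervals. -/
def Fll (B : Set (A × A)) : Set (A × A) :=
  {I | I.1 ≤ I.2 ∧ ∀ x : A, I.1 ≤ x → x ≤ I.2 →
    ∃ y : A, I.1 ≤ y ∧ y ≤ I.2 ∧ x ⊓ y = I.1 ∧ (x ⊔ y, I.2) ∈ B}

/-- `B`-critical intervals. -/
def Crt (B : Set (A × A)) : Set (A × A) :=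
  {I | I.1 ≤ I.2 ∧ ∀ x : A, I.1 ≤ x → x ≤ I.2 → x = I.1 ∨ (x, I.2) ∈ B}

/-- `B`-semicritical intervals: `[a, b]` where `b` is the supremum of a set `X ⊆ [a, b]` such that
every `[a, x]` with `x ∈ X` is `B`-critical. -/
def Sct (B : Set (A × A)) : Set (A × A) :=
  {I | I.1 ≤ I.2 ∧ ∃ X : Set A, X ⊆ Set.Icc I.1 I.2 ∧ sSup X = I.2 ∧ ∀ x ∈ X, (I.1, x) ∈ Crt B}

/-- Semi-simple intervals: `[a, b]` where `b` is the supremum of a set `X ⊆ [a, b]` such that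
every `[a, x]` with `x ∈ X` is simple. -/
def SSp (A : Type u) [CompleteLattice A] : Set (A × A) :=
  {I | I.1 ≤ I.2 ∧ ∃ X : Set A, X ⊆ Set.Icc I.1 I.2 ∧ sSup X = I.2 ∧ ∀ x ∈ X, (I.1, x) ∈ Smp A}

/-- Weakly atomic intervals: every non-trivial subinterval has a non-trivial simple subinterval. -/
def WA (A : Type u) [CompleteLattice A] : Set (A × A) :=
  {I | I.1 ≤ I.2 ∧ ∀ c d : A, I.1 ≤ c → c < d → d ≤ I.2 →
    ∃ x y : A, c ≤ x ∧ x < y ∧ y ≤ d ∧ (x, y) ∈ Smp A}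

/-- The Boyle construction: the division set generated by the `B`-full intervals. -/
def Boy (B : Set (A × A)) : Set (A × A) := Dvs (Fll B)

/-- The inflator associated with a set of intervals. -/
def inflator (B : Set (A × A)) (a : A) : A := sSup {x | (a, x) ∈ B}

/-- The ordinal iterates of `d : A → A`: `d⁰ = id`, `d^(α+1) = d ∘ d^α`, and pointwise suprema
at limit ordinals. -/
noncomputable def iter (d : A → A) (α : Ordinal.{u}) : A → A :=
  Ordinal.limitRecOn α id (fun _ f => d ∘ f) (fun l _ f a => ⨆ β : Set.Iio l, f β.1 β.2 a)

/-- `d^∞`, the eventual value of the iterates of `d`.  For an inflator `d` they form an ascending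
chain which is eventually constant, so that their supremum is the eventual value. -/
noncomputable def iterClosure (d : A → A) (a : A) : A := ⨆ α : Ordinal.{u}, iter d α a

/-- The division set `D_j` of a nucleus `j`. -/
def divisionSet (j : Nucleus A) : Set (A × A) := {I | I.1 ≤ I.2 ∧ I.2 ≤ j I.1}

/-- The relative socle derivative of the nucleus `j`. -/
def soc (j : Nucleus A) : A → A := inflator (Crt (divisionSet j))

/-- The relative Cantor-Bendixson derivative of the nucleus `j`. -/
def cbdRel (j : Nucleus A) : A → A := inflator (Fll (divisionSet j))

/-- The Cantor-Bendixson derivative of `A`. -/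
def cbd (A : Type u) [CompleteLattice A] : A → A := inflator (Cmp A)

/-- The nucleus `j` is spectral: the lattice of its fixed elements is complemented.  In that
lattice the bottom is `j ⊥`, the top is `⊤`, meets are those of `A`, and the join of `x` and `y`
is `j (x ⊔ y)`. -/
def IsSpectral (j : Nucleus A) : Prop :=
  ∀ x : A, j x = x → ∃ y : A, j y = y ∧ x ⊓ y = j ⊥ ∧ j (x ⊔ y) = ⊤

/-- The negation of `j` in the frame of nuclei: the largest nucleus that meets `j` in the identity
(see `le_neg_iff`). -/
noncomputable def neg (j : Nucleus A) : Nucleus A := sSup {k | k ⊓ j = ⊥}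

end Intervals

section Negation

variable {A : Type u} [CompleteLattice A]

/-- Zorn's lemma for a property that is preserved by suprema of non-empty chains. -/
theorem exists_maximal_of_chain (P : A → Prop) (x : A) (hx : P x)
    (hP : ∀ c : Set A, c.Nonempty → IsChain (· ≤ ·) c → (∀ z ∈ c, P z) → P (sSup c)) :
    ∃ m, x ≤ m ∧ Maximal P m := by
  refine zorn_le_nonempty₀ {z | P z} (fun c hc hch y hy => ?_) x hx
  exact ⟨sSup c, hP c ⟨y, hy⟩ hch hc, fun z hz => le_sSup hz⟩

/-- The least common fixed element of the nuclei of `S` above `x`. -/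
def commonFix (S : Set (Nucleus A)) (x : A) : A := sInf {z | x ≤ z ∧ ∀ k ∈ S, k z = z}

theorem le_commonFix (S : Set (Nucleus A)) (x : A) : x ≤ commonFix S x :=
  le_sInf fun _ hz => hz.1

theorem commonFix_le (S : Set (Nucleus A)) {x z : A} (h : x ≤ z) (hz : ∀ k ∈ S, k z = z) :
    commonFix S x ≤ z := sInf_le ⟨h, hz⟩

theorem commonFix_fixed (S : Set (Nucleus A)) (x : A) (k : Nucleus A) (hk : k ∈ S) :
    k (commonFix S x) = commonFix S x := by
  refine le_antisymm (le_sInf fun z hz => ?_) Nucleus.le_apply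
  calc k (commonFix S x) ≤ k z := k.monotone (sInf_le hz)
    _ = z := hz.2 k hk

theorem inf_sSup_le_of_chain [Idiom A] (a b : A) (c : Set A) (hc : IsChain (· ≤ ·) c)
    (h : ∀ z ∈ c, z ⊓ a ≤ b) : sSup c ⊓ a ≤ b := by
  rw [inf_comm, Idiom.inf_sSup_of_directedOn a c hc.directedOn]
  exact iSup₂_le fun z hz => by rw [inf_comm]; exact h z hz

theorem commonFix_inf_le [Idiom A] (S : Set (Nucleus A)) (x y : A) :
    commonFix S x ⊓ y ≤ commonFix S (x ⊓ y) := by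
  obtain ⟨m, hxm, hm⟩ := exists_maximal_of_chain (fun z => z ⊓ y ≤ commonFix S (x ⊓ y)) x
    (le_commonFix S _) (fun c _ hc h => inf_sSup_le_of_chain _ _ c hc h)
  refine le_trans (inf_le_inf_right y (commonFix_le S hxm fun k hk => ?_)) hm.prop
  refine le_antisymm (hm.2 ?_ Nucleus.le_apply) Nucleus.le_apply
  calc k m ⊓ y ≤ k m ⊓ k y := inf_le_inf_left _ Nucleus.le_apply
    _ = k (m ⊓ y) := Nucleus.map_inf.symm
    _ ≤ k (commonFix S (x ⊓ y)) := k.monotone hm.prop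
    _ = commonFix S (x ⊓ y) := commonFix_fixed S _ k hk

theorem commonFix_mono (S : Set (Nucleus A)) {x y : A} (h : x ≤ y) :
    commonFix S x ≤ commonFix S y :=
  commonFix_le S (h.trans (le_commonFix S y)) fun k hk => commonFix_fixed S y k hk

theorem commonFix_idem (S : Set (Nucleus A)) (x : A) :
    commonFix S (commonFix S x) ≤ commonFix S x :=
  commonFix_le S le_rfl fun k hk => commonFix_fixed S x k hk

/-- The supremum of a set of nuclei. -/
def commonFixNucleus [Idiom A] (S : Set (Nucleus A)) : Nucleus A where
  toFun := commonFix S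
  map_inf' x y := by
    refine le_antisymm (le_inf (commonFix_mono S inf_le_left) (commonFix_mono S inf_le_right)) ?_
    refine (commonFix_inf_le S x (commonFix S y)).trans ?_
    refine (commonFix_mono S ?_).trans (commonFix_idem S (x ⊓ y))
    rw [inf_comm, inf_comm x y]
    exact commonFix_inf_le S y x
  idempotent' := commonFix_idem S
  le_apply' := le_commonFix S

theorem sSup_nucleus_apply_le [Idiom A] (S : Set (Nucleus A)) {x z : A} (h : x ≤ z)
    (hz : ∀ k ∈ S, k z = z) : (sSup S : Nucleus A) x ≤ z := by
  have hle : sSup S ≤ commonFixNucleus S := by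
    refine sSup_le fun k hk => ?_
    rw [← Nucleus.coe_le_coe]
    intro w
    calc k w ≤ k (commonFix S w) := k.monotone (le_commonFix S w)
      _ = commonFix S w := commonFix_fixed S w k hk
  exact (Nucleus.coe_le_coe.mpr hle x).trans (commonFix_le S h hz)

theorem neg_inf_self [Idiom A] (j : Nucleus A) : neg j ⊓ j = ⊥ := by
  refine le_antisymm ?_ bot_le
  rw [← Nucleus.coe_le_coe]
  intro a
  change neg j a ⊓ j a ≤ a
  obtain ⟨m, ham, hm⟩ := exists_maximal_of_chain (fun z => a ≤ z ∧ z ⊓ j a ≤ a) a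
    ⟨le_rfl, inf_le_left⟩ (fun c hne hc h =>
      ⟨hne.elim fun z hz => (h z hz).1.trans (le_sSup hz),
        inf_sSup_le_of_chain _ _ c hc fun z hz => (h z hz).2⟩)
  refine le_trans (inf_le_inf_right _ (sSup_nucleus_apply_le _ ham fun k hk => ?_)) hm.prop.2
  refine le_antisymm (hm.2 ⟨ham.trans Nucleus.le_apply, ?_⟩ Nucleus.le_apply) Nucleus.le_apply
  have hk' : k m ⊓ j m = m := by
    have := congrArg (fun l : Nucleus A => l m) (show k ⊓ j = ⊥ from hk)
    simpa using this
  have h1 : k m ⊓ j a ≤ m := (inf_le_inf_left _ (j.monotone ham)).trans hk'.le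
  exact (le_inf h1 inf_le_right).trans hm.prop.2

theorem le_neg_iff [Idiom A] (j k : Nucleus A) : k ≤ neg j ↔ k ⊓ j = ⊥ :=
  ⟨fun h => le_bot_iff.mp ((inf_le_inf_right j h).trans (neg_inf_self j).le), fun h => le_sSup h⟩

end Negation

end IdiomTheory

/-! An interval lying in both `divisionSet j` and `divisionSet (neg j)` is trivial, and this is what
turns approximate statements into exact ones. Spectrality gives every `x` in `[a, b]` a complement
up to `j` (`IsSpectral.exists_compl`). If `[a, b]` is in `divisionSet (neg j)`, both errors lie in
the trivial intersection, so `[a, b]` is complemented. For the same reason, critical intervals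
inside `divisionSet (neg j)` are simple. Hence the part of `[a, b]` below the iterated socle is
semi-simple, and joining with a complement `y` of it carries its simple pieces to critical intervals
above `y`. For the Boyle part, a full interval `[m, b]` is cut at `j m ⊓ b`. The lower piece is
always complemented, so it collapses when `m` is closed under `cbd`; then the whole interval is
complemented and collapses too (`IsSpectral.le_of_mem_fll`). Both equalities of the second claim
follow. The last two claims hold because complemented weakly atomic intervals are semi-simple, and
compact generation forces weak atomicity. -/

namespace IdiomTheory

/-! ### Basic sets, division sets and their inflators -/

section BasicSets

variable {A : Type u} [CompleteLattice A]

theorem IsBasic.refl_mem {B : Set (A × A)} (h : IsBasic B) (a : A) : (a, a) ∈ B := by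
  obtain ⟨⟨c, d⟩, hI⟩ := h.nonempty
  have h1 : (d, d) ∈ B := h.subinterval c d d d (h.subset_all hI) le_rfl le_rfl hI
  have h2 : ((⊥ : A), (⊥ : A)) ∈ B :=
    h.similar (d, d) _ ⟨d, ⊥, Or.inr ⟨by simp, by simp⟩⟩ h1
  exact h.similar (⊥, ⊥) _ ⟨a, ⊥, Or.inl ⟨by simp, by simp⟩⟩ h2

theorem IsBasic.sup_mem {B : Set (A × A)} (h : IsBasic B) {a b x : A} (hab : a ≤ b)
    (hx : (a, x) ∈ B) : (b, b ⊔ x) ∈ B :=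
  h.similar (b ⊓ x, x) _ ⟨b, x, Or.inl ⟨rfl, rfl⟩⟩
    (h.subinterval a (b ⊓ x) x x (le_inf hab (h.subset_all hx)) inf_le_right le_rfl hx)

theorem IsBasic.inf_mem {B : Set (A × A)} (h : IsBasic B) {l t r : A} (hr : r ≤ t)
    (hl : (l, t) ∈ B) : (l ⊓ r, r) ∈ B :=
  h.similar (l, l ⊔ r) _ ⟨l, r, Or.inr ⟨rfl, rfl⟩⟩
    (h.subinterval l l (l ⊔ r) t le_rfl le_sup_left (sup_le (h.subset_all hl) hr) hl)

theorem isDivision_divisionSet (j : Nucleus A) : IsDivision (divisionSet j) where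
  subset_all _ h := h.1
  nonempty := ⟨(⊥, ⊥), le_rfl, bot_le⟩
  similar := by
    rintro I J ⟨l, r, ⟨rfl, rfl⟩ | ⟨rfl, rfl⟩⟩ ⟨-, h⟩
    · exact ⟨le_sup_left, sup_le Nucleus.le_apply (h.trans (j.monotone inf_le_left))⟩
    · refine ⟨inf_le_right, ?_⟩
      change r ≤ j (l ⊓ r)
      rw [Nucleus.map_inf]
      exact le_inf (le_sup_right.trans h) Nucleus.le_apply
  subinterval _ _ _ _ ha hab hb h := ⟨hab, (hb.trans h.2).trans (j.monotone ha)⟩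
  abut a b c hab hbc := by
    refine ⟨hab.1.trans hbc.1, hbc.2.trans ?_⟩
    exact (j.monotone hab.2).trans (Nucleus.idempotent (n := j) (x := a)).le
  sSup_mem a X hX h := by
    obtain ⟨x, hx⟩ := hX
    exact ⟨(h x hx).1.trans (le_sSup hx), sSup_le fun z hz => (h z hz).2⟩

theorem divisionSet_bot : divisionSet (⊥ : Nucleus A) = trivialIntervals A := by
  ext ⟨a, b⟩
  exact ⟨fun h => le_antisymm h.1 h.2, fun h => ⟨le_of_eq h, ge_of_eq h⟩⟩

theorem isDivision_trivialIntervals : IsDivision (trivialIntervals A) :=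
  divisionSet_bot (A := A) ▸ isDivision_divisionSet ⊥

/-- Makes closure properties of critical intervals available for simple ones; `Cmp A` unfolds to
`Fll (trivialIntervals A)` in the same way. -/
theorem smp_eq_crt : Smp A = Crt (trivialIntervals A) := by
  ext ⟨a, b⟩
  refine and_congr_right fun _ => ⟨fun h x hax hxb => ?_, ?_⟩
  · by_contra! hx
    exact h ⟨x, lt_of_le_of_ne hax hx.1.symm, lt_of_le_of_ne hxb hx.2⟩
  · rintro h ⟨x, hax, hxb⟩
    exact (h x hax.le hxb.le).elim hax.ne' hxb.ne

theorem fll_mono {B C : Set (A × A)} (h : B ⊆ C) : Fll B ⊆ Fll C := fun _ hI =>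
  ⟨hI.1, fun x hx hx' => (hI.2 x hx hx').imp fun _ hy => ⟨hy.1, hy.2.1, hy.2.2.1, h hy.2.2.2⟩⟩

theorem crt_mono {B C : Set (A × A)} (h : B ⊆ C) : Crt B ⊆ Crt C :=
  fun _ hI => ⟨hI.1, fun x hx hx' => (hI.2 x hx hx').imp_right fun e => h e⟩

theorem IsBasic.trivialIntervals_subset {B : Set (A × A)} (h : IsBasic B) :
    trivialIntervals A ⊆ B := by
  rintro ⟨a, b⟩ e
  obtain rfl : a = b := e
  exact h.refl_mem a

theorem smp_subset_crt {B : Set (A × A)} (h : IsBasic B) : Smp A ⊆ Crt B :=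
  smp_eq_crt (A := A) ▸ crt_mono h.trivialIntervals_subset

theorem cmp_subset_fll {B : Set (A × A)} (h : IsBasic B) : Cmp A ⊆ Fll B :=
  fll_mono h.trivialIntervals_subset

theorem isDivision_dvs {B : Set (A × A)} (hB : B ⊆ allIntervals A) : IsDivision (Dvs B) where
  subset_all _ h := h _
    -- The set of all intervals is itself a division set, so it takes part in the intersection
    -- defining `Dvs B`.
    ⟨⟨⟨⟨subset_rfl, ⟨(⊥, ⊥), le_rfl⟩, by
      rintro I J ⟨l, r, ⟨rfl, rfl⟩ | ⟨rfl, rfl⟩⟩ -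
      exacts [le_sup_left, inf_le_right]⟩, fun _ _ _ _ _ h _ _ => h⟩,
      fun _ _ _ h h' => le_trans h h'⟩,
      fun _ _ ⟨_, hx⟩ h => (h _ hx).trans (le_sSup hx)⟩ hB
  nonempty := ⟨(⊥, ⊥), fun _ hE _ => hE.toIsBasic.refl_mem ⊥⟩
  similar I J hs hI E hE hBE := hE.similar I J hs (hI E hE hBE)
  subinterval a' a b b' ha hab hb h E hE hBE := hE.subinterval a' a b b' ha hab hb (h E hE hBE)
  abut a b c h h' E hE hBE := hE.abut a b c (h E hE hBE) (h' E hE hBE)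
  sSup_mem a X hX h E hE hBE := hE.sSup_mem a X hX fun x hx => h x hx E hE hBE

theorem subset_dvs (B : Set (A × A)) : B ⊆ Dvs B := fun _ hI _ _ hBE => hBE hI

theorem dvs_subset {B E : Set (A × A)} (hE : IsDivision E) (h : B ⊆ E) : Dvs B ⊆ E :=
  fun _ hI => hI E hE h

theorem le_inflator_of_mem {B : Set (A × A)} {a x : A} (h : (a, x) ∈ B) : x ≤ inflator B a :=
  le_sSup h

theorem le_inflator {B : Set (A × A)} (h : IsBasic B) (a : A) : a ≤ inflator B a :=
  le_sSup (h.refl_mem a)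

theorem inflator_monotone {B : Set (A × A)} (h : IsBasic B) : Monotone (inflator B) :=
  fun _ _ hab => sSup_le fun _ hx => le_sup_right.trans (le_sSup (h.sup_mem hab hx))

theorem inflator_subset_mono {B C : Set (A × A)} (h : B ⊆ C) (a : A) :
    inflator B a ≤ inflator C a := sSup_le_sSup fun _ hx => h hx

theorem IsDivision.inflator_mem {B : Set (A × A)} (h : IsDivision B) (a : A) :
    (a, inflator B a) ∈ B :=
  h.sSup_mem a _ ⟨a, h.toIsBasic.refl_mem a⟩ fun _ hx => hx

/-- The nucleus of a division set. -/
def nucleusOfDivision (B : Set (A × A)) (h : IsDivision B) : Nucleus A where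
  toFun := inflator B
  map_inf' a b := by
    have hm := inflator_monotone h.toIsBasic
    refine le_antisymm (le_inf (hm inf_le_left) (hm inf_le_right)) (le_sSup ?_)
    -- The passage from `a ⊓ b` to `inflator B a ⊓ inflator B b` is made by two abutting intervals,
    -- enlarging one factor at a time.
    have h1 : (a ⊓ b, inflator B a ⊓ b) ∈ B := by
      have := h.toIsBasic.inf_mem (r := inflator B a ⊓ b) inf_le_left (h.inflator_mem a)
      rwa [← inf_assoc, inf_eq_left.mpr (le_inflator h.toIsBasic a)] at this
    have h2 : (inflator B a ⊓ b, inflator B a ⊓ inflator B b) ∈ B := by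
      have := h.toIsBasic.inf_mem (r := inflator B a ⊓ inflator B b) inf_le_right
        (h.inflator_mem b)
      rwa [inf_left_comm, inf_eq_left.mpr (le_inflator h.toIsBasic b)] at this
    exact h.abut _ _ _ h1 h2
  idempotent' a := le_sSup (h.abut _ _ _ (h.inflator_mem a) (h.inflator_mem _))
  le_apply' := le_inflator h.toIsBasic

theorem subset_divisionSet_nucleusOfDivision {B : Set (A × A)} (h : IsDivision B) :
    B ⊆ divisionSet (nucleusOfDivision B h) :=
  fun I hI => ⟨h.subset_all hI, le_sSup (show (I.1, I.2) ∈ B from hI)⟩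

end BasicSets

/-! ### Full, critical and complemented intervals in modular lattices -/

section Modular

variable {A : Type u} [CompleteLattice A] [IsModularLattice A]

/-- Modularity transports partial complements: along a similarity by `l ⊔ ·` or `· ⊓ r`, and to a
subinterval `[a, b]` by `z ↦ a ⊔ z ⊓ b`. -/
theorem isBasic_fll {B : Set (A × A)} (h : IsBasic B) : IsBasic (Fll B) where
  subset_all _ hI := hI.1
  nonempty := ⟨(⊥, ⊥), le_rfl, fun x _ hx => by
    obtain rfl : x = ⊥ := le_bot_iff.mp hx
    exact ⟨⊥, le_rfl, le_rfl, by simp, by simpa using h.refl_mem ⊥⟩⟩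
  similar := by
    rintro I J ⟨l, r, ⟨rfl, rfl⟩ | ⟨rfl, rfl⟩⟩ ⟨-, hI⟩
    · refine ⟨le_sup_left, fun x hlx hx => ?_⟩
      obtain ⟨y, hy, hyr, hxy, hB⟩ := hI (x ⊓ r) (inf_le_inf_right r hlx) inf_le_right
      dsimp only at *
      have hx' : l ⊔ r ⊓ x = x := by
        rw [← sup_inf_assoc_of_le r hlx, inf_eq_right.mpr hx]
      refine ⟨l ⊔ y, le_sup_left, sup_le_sup_left hyr l, ?_, ?_⟩
      · rw [inf_comm, sup_inf_assoc_of_le y hlx]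
        refine le_antisymm (sup_le le_rfl ?_) le_sup_left
        refine le_trans ?_ (hxy.le.trans inf_le_left)
        exact le_inf (le_inf inf_le_right (inf_le_left.trans hyr)) inf_le_left
      · have := h.sup_mem (b := l ⊔ (x ⊓ r ⊔ y)) le_sup_right hB
        have e1 : l ⊔ (x ⊓ r ⊔ y) = x ⊔ (l ⊔ y) := by
          rw [← sup_assoc, inf_comm, hx', ← sup_assoc, sup_eq_left.mpr hlx]
        have e2 : l ⊔ (x ⊓ r ⊔ y) ⊔ r = l ⊔ r := by
          rw [sup_assoc, sup_eq_right.mpr (sup_le inf_le_right hyr)]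
        rwa [e2, e1] at this
    · refine ⟨inf_le_right, fun x hlx hx => ?_⟩
      obtain ⟨y, hy, hyr, hxy, hB⟩ := hI (l ⊔ x) le_sup_left (sup_le_sup_left hx l)
      dsimp only at *
      refine ⟨y ⊓ r, inf_le_inf_right r hy, inf_le_right, ?_, ?_⟩
      · refine le_antisymm (le_inf ?_ (inf_le_left.trans hx)) (le_inf hlx (inf_le_inf_right r hy))
        exact (inf_le_inf le_sup_right inf_le_left).trans hxy.le
      · have := h.inf_mem (r := r) le_sup_right hB
        rwa [sup_right_comm, sup_eq_right.mpr hy, sup_comm, sup_inf_assoc_of_le y hx] at this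
  subinterval a' a b b' ha hab hb hI := by
    refine ⟨hab, fun x hax hxb => ?_⟩
    obtain ⟨z, hz, hzb, hxz, hB⟩ := hI.2 x (ha.trans hax) (hxb.trans hb)
    dsimp only at *
    refine ⟨a ⊔ z ⊓ b, le_sup_left, sup_le hab inf_le_right, ?_, ?_⟩
    · rw [inf_comm, sup_inf_assoc_of_le _ hax]
      refine le_antisymm (sup_le le_rfl ?_) le_sup_left
      exact le_trans (le_inf inf_le_right (inf_le_left.trans inf_le_left)) (hxz.le.trans ha)
    · rw [← sup_assoc, sup_eq_left.mpr hax, ← sup_inf_assoc_of_le z hxb]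
      exact h.inf_mem hb hB

theorem isBasic_crt {B : Set (A × A)} (h : IsBasic B) : IsBasic (Crt B) where
  subset_all _ hI := hI.1
  nonempty := ⟨(⊥, ⊥), le_rfl, fun _ _ hx => Or.inl (le_bot_iff.mp hx)⟩
  similar := by
    rintro I J ⟨l, r, ⟨rfl, rfl⟩ | ⟨rfl, rfl⟩⟩ ⟨-, hI⟩
    · refine ⟨le_sup_left, fun x hlx hx => ?_⟩
      dsimp only at *
      refine (hI (x ⊓ r) (inf_le_inf_right r hlx) inf_le_right).imp (fun e => ?_) fun hB => ?_
      · rw [← inf_eq_right.mpr hx, sup_inf_assoc_of_le r hlx, inf_comm, e]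
        exact sup_eq_left.mpr inf_le_left
      · have := h.sup_mem inf_le_left hB
        rwa [le_antisymm (sup_le hx le_sup_right) (sup_le_sup_right hlx r)] at this
    · refine ⟨inf_le_right, fun x hlx hx => ?_⟩
      dsimp only at *
      refine (hI (x ⊔ l) le_sup_right (sup_le (hx.trans le_sup_right) le_sup_left)).imp
        (fun e => ?_) fun hB => ?_
      · exact le_antisymm (le_inf (le_sup_left.trans e.le) hx) hlx
      · have := h.inf_mem (r := r) le_sup_right hB
        rwa [sup_inf_assoc_of_le l hx, sup_eq_left.mpr hlx] at this
  subinterval a' a b b' ha hab hb hI := by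
    refine ⟨hab, fun x hax hxb => ?_⟩
    refine (hI.2 x (ha.trans hax) (hxb.trans hb)).imp (fun e => ?_) fun hB => ?_
    · exact le_antisymm (e.le.trans ha) hax
    · exact h.subinterval x x b b' le_rfl hxb hb hB

theorem isBasic_cmp : IsBasic (Cmp A) := isBasic_fll isDivision_trivialIntervals.toIsBasic

theorem isBasic_smp : IsBasic (Smp A) := by
  rw [smp_eq_crt]
  exact isBasic_crt isDivision_trivialIntervals.toIsBasic

/-- A complemented interval is semi-simple if every non-trivial initial part of it starts with a
non-trivial simple interval. -/
theorem mem_ssp_of_mem_cmp {a b : A} (h : (a, b) ∈ Cmp A)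
    (hv : ∀ v, a < v → v ≤ b → ∃ w, a < w ∧ w ≤ v ∧ (a, w) ∈ Smp A) : (a, b) ∈ SSp A := by
  refine ⟨h.1, {x | x ∈ Set.Icc a b ∧ (a, x) ∈ Smp A}, fun x hx => hx.1, ?_, fun x hx => hx.2⟩
  set X := {x | x ∈ Set.Icc a b ∧ (a, x) ∈ Smp A}
  have haX : a ≤ sSup X := le_sSup ⟨⟨le_rfl, h.1⟩, isBasic_smp.refl_mem a⟩
  -- If the complement `v` of the join of the simple pieces were non-trivial, it would contain a
  -- further simple piece, lying below both `v` and that join.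
  obtain ⟨v, hav, hvb, hXv, hXv'⟩ := h.2 (sSup X) haX (sSup_le fun x hx => hx.1.2)
  rcases eq_or_lt_of_le hav with e | hlt
  · dsimp only at *
    rw [← hXv', ← e, sup_eq_left.mpr haX]
  · obtain ⟨w, haw, hwv, hw⟩ := hv v hlt hvb
    have hwX : w ∈ X := ⟨⟨haw.le, hwv.trans hvb⟩, hw⟩
    exact absurd ((le_inf (le_sSup hwX) hwv).trans hXv.le) haw.not_ge

/-- A simple `[x, y]` found anywhere above `a` is moved down to start at `a`: it is similar to `[a,
z]` for a complement `z` of `x` in `[a, y]`. -/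
theorem mem_ssp_of_weaklyAtomic {a b : A} (h : (a, b) ∈ Cmp A) (hw : (a, b) ∈ WA A) :
    (a, b) ∈ SSp A := by
  refine mem_ssp_of_mem_cmp h fun v hav hvb => ?_
  obtain ⟨x, y, hax, hxy, hyv, hs⟩ := hw.2 a v le_rfl hav hvb
  obtain ⟨z, haz, hzy, hxz, hxz'⟩ :=
    (isBasic_cmp.subinterval a a y b le_rfl (hax.trans hxy.le) (hyv.trans hvb) h).2 x hax hxy.le
  dsimp only at *
  refine ⟨z, lt_of_le_of_ne haz ?_, hzy.trans hyv, ?_⟩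
  · rintro rfl
    rw [sup_eq_left.mpr hax] at hxz'
    exact hxy.ne hxz'
  · have := isBasic_smp.inf_mem hzy hs
    rwa [hxz] at this

end Modular

/-! ### Transfinite iterates and their closure -/

section Iteration

variable {A : Type u} [CompleteLattice A]

theorem iter_zero (d : A → A) : iter d 0 = id := Ordinal.limitRecOn_zero ..

theorem iter_succ (d : A → A) (α : Ordinal.{u}) : iter d (α + 1) = d ∘ iter d α :=
  Ordinal.limitRecOn_add_one ..

theorem iter_limit (d : A → A) {α : Ordinal.{u}} (h : Order.IsSuccLimit α) (a : A) :
    iter d α a = ⨆ β : Set.Iio α, iter d β.1 a := by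
  rw [iter, Ordinal.limitRecOn_limit (h := h)]
  rfl

theorem iterClosure_le {d : A → A} (hd : Monotone d) {a m : A} (ha : a ≤ m) (hm : d m ≤ m) :
    iterClosure d a ≤ m := by
  refine iSup_le fun α => ?_
  induction α using Ordinal.limitRecOn with
  | zero => simpa [iter_zero] using ha
  | add_one α ih => rw [iter_succ]; exact (hd ih).trans hm
  | limit α hα ih => rw [iter_limit d hα]; exact iSup_le fun β => ih β.1 β.2

theorem le_iterClosure (d : A → A) (a : A) : a ≤ iterClosure d a := by
  refine le_trans ?_ (le_iSup (fun β : Ordinal.{u} => iter d β a) 0)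
  rw [iter_zero, id]

theorem iter_le_iter {d : A → A} (hd : ∀ x, x ≤ d x) (a : A) {α β : Ordinal.{u}} (h : α ≤ β) :
    iter d α a ≤ iter d β a := by
  induction β using Ordinal.limitRecOn with
  | zero => rw [nonpos_iff_eq_zero.mp h]
  | add_one β ih =>
    rcases h.eq_or_lt with rfl | h
    · exact le_rfl
    · rw [iter_succ]
      exact (ih (Order.lt_add_one_iff.mp h)).trans (hd _)
  | limit β hβ ih =>
    rcases h.eq_or_lt with rfl | h
    · exact le_rfl
    · rw [iter_limit d hβ]
      exact le_iSup (fun γ : Set.Iio β => iter d γ.1 a) ⟨α, h⟩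

/-- The ordinals do not inject into `A`, so two iterates agree; since the chain ascends, the earlier
one is already `d`-closed. With `iterClosure_le`, this makes `iterClosure d a` the least `d`-closed
element above `a`. -/
theorem map_iterClosure_le {d : A → A} (hd : ∀ x, x ≤ d x) (hm : Monotone d) (a : A) :
    d (iterClosure d a) ≤ iterClosure d a := by
  obtain ⟨α, β, e, hne⟩ : ∃ α β : Ordinal.{u}, iter d α a = iter d β a ∧ α ≠ β := by
    simpa [Function.Injective] using not_injective_of_ordinal fun α : Ordinal.{u} => iter d α a
  wlog h : α < β generalizing α β
  · exact this β α e.symm hne.symm (lt_of_le_of_ne (not_lt.mp h) hne.symm)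
  have hfix : d (iter d α a) ≤ iter d α a := by
    have := iter_le_iter hd a (Order.add_one_le_of_lt h)
    rwa [← e, iter_succ] at this
  have hle : iterClosure d a ≤ iter d α a := by
    refine iterClosure_le hm ?_ hfix
    simpa [iter_zero] using iter_le_iter hd a (zero_le (a := α))
  exact (hm hle).trans (hfix.trans (le_iSup (fun β : Ordinal.{u} => iter d β a) α))

end Iteration

/-! ### Spectral nuclei and the division set of the negation -/

section Spectral

variable {A : Type u} [CompleteLattice A] [Idiom A] {j : Nucleus A}

theorem divisionSet_neg_inter (j : Nucleus A) :
    divisionSet (neg j) ∩ divisionSet j ⊆ trivialIntervals A := by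
  rintro ⟨a, b⟩ ⟨h, h'⟩
  have e := congrArg (fun l : Nucleus A => l a) (neg_inf_self j)
  have e' : neg j a ⊓ j a = a := e
  exact le_antisymm h.1 ((le_inf h.2 h'.2).trans e'.le)

/-- A competing division set `E` yields a nucleus. Its meet with `j` is the identity because `[a,
inflator E a ⊓ j a]` lies in both `E` and `divisionSet j`. -/
theorem isGreatest_divisionSet_neg (j : Nucleus A) :
    IsGreatest {E : Set (A × A) | IsDivision E ∧ E ∩ divisionSet j ⊆ trivialIntervals A}
      (divisionSet (neg j)) := by
  refine ⟨⟨isDivision_divisionSet _, divisionSet_neg_inter j⟩, fun E ⟨hE, hEj⟩ I hI => ?_⟩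
  have hle : nucleusOfDivision E hE ≤ neg j := by
    rw [le_neg_iff, ← le_bot_iff, ← Nucleus.coe_le_coe]
    intro a
    change inflator E a ⊓ j a ≤ a
    have ha : a ≤ inflator E a ⊓ j a := le_inf (le_inflator hE.toIsBasic a) Nucleus.le_apply
    exact ge_of_eq (hEj (a := (a, inflator E a ⊓ j a))
      ⟨hE.subinterval a a _ _ le_rfl ha inf_le_left (hE.inflator_mem a), ha, inf_le_right⟩)
  have h := subset_divisionSet_nucleusOfDivision hE hI
  exact ⟨h.1, h.2.trans (Nucleus.coe_le_coe.mpr hle I.1)⟩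

theorem mem_smp_of_mem_crt {a b : A} (h : (a, b) ∈ divisionSet (neg j))
    (hc : (a, b) ∈ Crt (divisionSet j)) : (a, b) ∈ Smp A := by
  rw [smp_eq_crt]
  refine ⟨h.1, fun x hax hxb => (hc.2 x hax hxb).imp_right fun hx => ?_⟩
  exact divisionSet_neg_inter j
    ⟨(isDivision_divisionSet (neg j)).subinterval a x b b hax hxb le_rfl h, hx⟩

/-- Suppose no non-trivial simple interval starts at `a` below `v`, and take `m` maximal with `m ⊓ v
≤ a`. A critical `[m, x]` restricts to `[a, x ⊓ v]`, which is simple, hence trivial, so `x ≤ m`.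
Thus `m` is closed under `soc j` and bounds the iterated socle, giving `v ≤ m`, a contradiction. -/
theorem mem_ssp_inf_iterClosure_soc {a b : A} (h : (a, b) ∈ divisionSet (neg j))
    (hc : (a, b) ∈ Cmp A) : (a, b ⊓ iterClosure (soc j) a) ∈ SSp A := by
  have hk := (isDivision_divisionSet (neg j)).toIsBasic
  have hcrt := isBasic_crt (isDivision_divisionSet j).toIsBasic
  have has : a ≤ b ⊓ iterClosure (soc j) a := le_inf hc.1 (le_iterClosure _ _)
  refine mem_ssp_of_mem_cmp (isBasic_cmp.subinterval a a _ b le_rfl has inf_le_left hc)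
    fun v hav hvs => ?_
  by_contra! hno
  obtain ⟨m, ham, hm⟩ := exists_maximal_of_chain (fun z => a ≤ z ∧ z ⊓ v ≤ a) a
    ⟨le_rfl, inf_le_left⟩ (fun c hne hc h =>
      ⟨hne.elim fun z hz => (h z hz).1.trans (le_sSup hz),
        inf_sSup_le_of_chain _ _ c hc fun z hz => (h z hz).2⟩)
  have hsoc : soc j m ≤ m := by
    refine sSup_le fun x hx => hm.2 ⟨ham.trans hx.1, ?_⟩ hx.1
    have hmv : m ⊓ (x ⊓ v) = a := by
      refine le_antisymm ((inf_le_inf_left m inf_le_right).trans hm.prop.2) ?_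
      exact le_inf ham (le_inf (ham.trans hx.1) hav.le)
    have h1 : (a, x ⊓ v) ∈ Crt (divisionSet j) := hmv ▸ hcrt.inf_mem inf_le_left hx
    have h2 : (a, x ⊓ v) ∈ divisionSet (neg j) :=
      hk.subinterval a a _ b le_rfl h1.1 (inf_le_right.trans (hvs.trans inf_le_left)) h
    by_contra hlt
    exact hno (x ⊓ v) (lt_of_le_not_ge h1.1 hlt) inf_le_right (mem_smp_of_mem_crt h2 h1)
  have hvm : v ≤ m := (hvs.trans inf_le_right).trans
    (iterClosure_le (inflator_monotone hcrt) ham hsoc)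
  exact hav.not_ge ((le_inf hvm le_rfl).trans hm.prop.2)

theorem IsSpectral.exists_compl (hj : IsSpectral j) {a x b : A} (hax : a ≤ x) (hxb : x ≤ b) :
    ∃ z, a ≤ z ∧ z ≤ b ∧ x ⊓ z ≤ j a ∧ b ≤ j (x ⊔ z) := by
  obtain ⟨c, -, hc, hc'⟩ := hj (j x) (Nucleus.idempotent x)
  have hle : j a ≤ j x := j.monotone hax
  -- Relative complement in the modular way: the complement `c` of `j x` in the fixed lattice is
  -- joined with `j a`, closed under `j`, and cut off at `b`.
  refine ⟨j (j a ⊔ c) ⊓ b, le_inf ?_ (hax.trans hxb), inf_le_right, ?_, ?_⟩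
  · exact Nucleus.le_apply.trans (le_sup_left.trans Nucleus.le_apply)
  · calc x ⊓ (j (j a ⊔ c) ⊓ b) ≤ j (j a ⊔ c) ⊓ j (j x) :=
          le_inf (inf_le_right.trans inf_le_left)
            (inf_le_left.trans (Nucleus.le_apply.trans Nucleus.le_apply))
      _ = j ((j a ⊔ c) ⊓ j x) := Nucleus.map_inf.symm
      _ = j (j a ⊔ c ⊓ j x) := by rw [sup_inf_assoc_of_le c hle]
      _ ≤ j (j a) := j.monotone (sup_le le_rfl (by rw [inf_comm, hc]; exact j.monotone bot_le))
      _ = j a := Nucleus.idempotent a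
  · have htop : j (x ⊔ j (j a ⊔ c)) = ⊤ := by
      refine top_le_iff.mp (hc'.ge.trans ?_)
      calc j (j x ⊔ c) ≤ j (j (x ⊔ j (j a ⊔ c))) := by
            refine j.monotone (sup_le (j.monotone le_sup_left) ?_)
            exact le_sup_right.trans (Nucleus.le_apply.trans (le_sup_right.trans Nucleus.le_apply))
        _ = j (x ⊔ j (j a ⊔ c)) := Nucleus.idempotent _
    rw [← sup_inf_assoc_of_le _ hxb, Nucleus.map_inf, htop, top_inf_eq]
    exact Nucleus.le_apply

theorem IsSpectral.divisionSet_neg_subset_cmp (hj : IsSpectral j) :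
    divisionSet (neg j) ⊆ Cmp A := by
  rintro ⟨a, b⟩ h
  refine ⟨h.1, fun x hax hxb => ?_⟩
  have hk := (isDivision_divisionSet (neg j)).toIsBasic
  obtain ⟨z, haz, hzb, hxz, hxz'⟩ := hj.exists_compl hax hxb
  have ha : a ≤ x ⊓ z := le_inf hax haz
  have hb : x ⊔ z ≤ b := sup_le hxb hzb
  refine ⟨z, haz, hzb, ?_, ?_⟩
  · exact (divisionSet_neg_inter j (a := (a, x ⊓ z))
      ⟨hk.subinterval a a _ b le_rfl ha (inf_le_right.trans hzb) h, ha, hxz⟩ : a = x ⊓ z).symm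
  · exact divisionSet_neg_inter j (a := (x ⊔ z, b))
      ⟨hk.subinterval a _ b b (hax.trans le_sup_left) hb le_rfl h, hb, hxz'⟩

/-- A `D_{¬j}`-full interval with `D_j`-part of the bottom trivial is complemented. -/
theorem IsSpectral.mem_cmp_of_mem_fll (hj : IsSpectral j) {a b : A}
    (h : (a, b) ∈ Fll (divisionSet (neg j))) (ha : j a ⊓ b ≤ a) : (a, b) ∈ Cmp A := by
  refine ⟨h.1, fun x hax hxb => ?_⟩
  obtain ⟨z, haz, hzb, hxz, hxz'⟩ := hj.exists_compl hax hxb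
  have hp : x ⊔ z ≤ b := sup_le hxb hzb
  refine ⟨z, haz, hzb, ?_, ?_⟩
  · exact le_antisymm ((le_inf hxz (inf_le_right.trans hzb)).trans ha) (le_inf hax haz)
  · obtain ⟨t, hat, htb, hpt, hk⟩ := h.2 (x ⊔ z) (hax.trans le_sup_left) hp
    dsimp only at *
    -- Since `t ≤ b ≤ j (x ⊔ z)`, also `t ≤ j ((x ⊔ z) ⊓ t) = j a`, so the partial complement `t` of
    -- `x ⊔ z` is trivial. Then `[x ⊔ z, b]` lies in both division sets.
    have hta : t ≤ a := by
      refine le_trans (le_inf ?_ htb) ha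
      rw [← hpt, Nucleus.map_inf]
      exact le_inf (htb.trans hxz') Nucleus.le_apply
    rw [sup_eq_left.mpr (hta.trans (hax.trans le_sup_left))] at hk
    exact divisionSet_neg_inter j ⟨hk, hp, hxz'⟩

theorem mem_cmp_of_mem_fll_of_le {a b : A} (h : (a, b) ∈ Fll (divisionSet (neg j)))
    (hb : b ≤ j a) : (a, b) ∈ Cmp A := by
  refine ⟨h.1, fun x hax hxb => (h.2 x hax hxb).imp fun y hy => ?_⟩
  refine ⟨hy.1, hy.2.1, hy.2.2.1, divisionSet_neg_inter j (a := (x ⊔ y, b)) ⟨hy.2.2.2, ?_, ?_⟩⟩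
  · exact sup_le hxb hy.2.1
  · exact hb.trans (j.monotone (hax.trans le_sup_left))

/-- Being closed under `cbd` is applied twice: to `[m, j m ⊓ b]`, and then, once that is trivial, to
all of `[m, b]`. -/
theorem IsSpectral.le_of_mem_fll (hj : IsSpectral j) {m b : A} (hm : cbd A m ≤ m)
    (h : (m, b) ∈ Fll (divisionSet (neg j))) : b ≤ m := by
  refine (le_inflator_of_mem (hj.mem_cmp_of_mem_fll h ((le_inflator_of_mem ?_).trans hm))).trans hm
  have hfll := isBasic_fll (isDivision_divisionSet (neg j)).toIsBasic
  exact mem_cmp_of_mem_fll_of_le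
    (hfll.subinterval m m _ b le_rfl (le_inf Nucleus.le_apply h.1) inf_le_right h) inf_le_left

theorem IsSpectral.boy_divisionSet_neg (hj : IsSpectral j) :
    Boy (divisionSet (neg j)) = Dvs (Cmp A) := by
  have hk := (isDivision_divisionSet (neg j)).toIsBasic
  have hD : IsDivision (Dvs (Cmp A)) := isDivision_dvs isBasic_cmp.subset_all
  have hF : IsDivision (Boy (divisionSet (neg j))) :=
    isDivision_dvs (isBasic_fll hk).subset_all
  refine subset_antisymm (dvs_subset hD ?_) (dvs_subset hF ((cmp_subset_fll hk).trans
    (subset_dvs _)))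
  rintro ⟨a, b⟩ h
  have hm : cbd A (inflator (Dvs (Cmp A)) a) ≤ inflator (Dvs (Cmp A)) a :=
    (inflator_subset_mono (subset_dvs _) _).trans
      (Nucleus.idempotent (n := nucleusOfDivision _ hD) (x := a)).le
  -- The full interval is pushed up to start at the `cbd`-closed element `inflator (Dvs (Cmp A)) a`,
  -- which must then lie above `b`.
  have hb := hj.le_of_mem_fll hm ((isBasic_fll hk).sup_mem (le_inflator hD.toIsBasic a) h)
  exact hD.subinterval a a b _ le_rfl h.1 (le_sup_right.trans hb) (hD.inflator_mem a)

theorem IsSpectral.iterClosure_cbdRel_neg (hj : IsSpectral j) :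
    iterClosure (cbdRel (neg j)) = iterClosure (cbd A) := by
  have hk := (isDivision_divisionSet (neg j)).toIsBasic
  funext a
  refine le_antisymm ?_ ?_
  · refine iterClosure_le (inflator_monotone (isBasic_fll hk)) (le_iterClosure _ a) ?_
    exact sSup_le fun x hx => hj.le_of_mem_fll
      (map_iterClosure_le (le_inflator isBasic_cmp) (inflator_monotone isBasic_cmp) a) hx
  · refine iterClosure_le (inflator_monotone isBasic_cmp) (le_iterClosure _ a) ?_
    exact (inflator_subset_mono (cmp_subset_fll hk) _).trans
      (map_iterClosure_le (le_inflator (isBasic_fll hk)) (inflator_monotone (isBasic_fll hk)) a)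

end Spectral

/-! ### Compact generation and the main theorem -/

theorem mem_wa_of_isCompactlyGenerated {A : Type u} [CompleteLattice A] [IsCompactlyGenerated A]
    {a b : A} (h : a ≤ b) : (a, b) ∈ WA A := by
  refine ⟨h, fun c d _ hcd _ => ?_⟩
  obtain ⟨w, hw, hwd, hwc⟩ : ∃ w : A, IsCompactElement w ∧ w ≤ d ∧ ¬ w ≤ c := by
    by_contra! H
    exact hcd.not_ge (le_iff_compact_le_imp.mpr fun w hw hwd => H w hw hwd)
  -- Compactness of `w` keeps `¬ w ≤ z` under suprema of chains. Anything strictly above the maximal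
  -- `m` and below `c ⊔ w` contains `w`, so it is `c ⊔ w`.
  obtain ⟨m, hcm, hm⟩ := exists_maximal_of_chain (fun z => z ≤ c ⊔ w ∧ ¬ w ≤ z) c
    ⟨le_sup_left, hwc⟩ (fun s hne hs hz => by
      refine ⟨sSup_le fun z hzs => (hz z hzs).1, fun hle => ?_⟩
      obtain ⟨z, hzs, hwz⟩ := hw s _ hne hs.directedOn (isLUB_sSup s) hle
      exact (hz z hzs).2 hwz)
  refine ⟨m, c ⊔ w, hcm, lt_of_le_of_ne hm.prop.1 ?_, sup_le hcd.le hwd, hm.prop.1, ?_⟩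
  · rintro rfl
    exact hm.prop.2 le_sup_right
  · rintro ⟨x, hmx, hx⟩
    have hwx : w ≤ x := by
      by_contra hwx
      exact hmx.not_ge (hm.2 ⟨hx.le, hwx⟩ hmx.le)
    exact hx.not_ge (sup_le (hcm.trans hmx.le) hwx)

end IdiomTheory
open IdiomTheory in
theorem mainTheorem10 {A : Type u} [CompleteLattice A] [Idiom A] (j : Nucleus A)
    (hj : IsSpectral j) :
    -- `D_{¬j}` is the negation of `D_j` in the lattice of division sets
    IsGreatest {E : Set (A × A) | IsDivision E ∧ E ∩ divisionSet j ⊆ trivialIntervals A}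
      (divisionSet (neg j)) ∧
    -- intervals of `D_{¬j}` are complemented and have a semicritical top part
    (∀ a b : A, (a, b) ∈ divisionSet (neg j) →
      (a, b) ∈ Cmp A ∧
      ∃ y ∈ Set.Icc a b,
        y ⊓ (b ⊓ iterClosure (soc j) a) = a ∧ y ⊔ (b ⊓ iterClosure (soc j) a) = b ∧
        (y, b) ∈ Sct (divisionSet j)) ∧
    -- the Boyle derivative of `D_{¬j}`, as a division set and as a nucleus
    Boy (divisionSet (neg j)) = Dvs (Cmp A) ∧
    iterClosure (cbdRel (neg j)) = iterClosure (cbd A) ∧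
    -- semi-simplicity
    (∀ a b : A, (a, b) ∈ divisionSet (neg j) ∩ WA A → (a, b) ∈ SSp A) ∧
    (IsCompactlyGenerated A → ∀ a b : A, (a, b) ∈ divisionSet (neg j) → (a, b) ∈ SSp A) := by
  have hcmp := hj.divisionSet_neg_subset_cmp
  refine ⟨isGreatest_divisionSet_neg j, fun a b h => ⟨hcmp h, ?_⟩, hj.boy_divisionSet_neg,
    hj.iterClosure_cbdRel_neg, fun a b h => mem_ssp_of_weaklyAtomic (hcmp h.1) h.2,
    fun _ a b h => mem_ssp_of_weaklyAtomic (hcmp h) (mem_wa_of_isCompactlyGenerated h.1)⟩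
  have hj' := (isDivision_divisionSet j).toIsBasic
  have has : a ≤ b ⊓ iterClosure (soc j) a := le_inf h.1 (le_iterClosure _ _)
  obtain ⟨y, hay, hyb, hsy, hsy'⟩ := (hcmp h).2 _ has inf_le_left
  obtain ⟨-, X, hX, hXs, hXsmp⟩ := mem_ssp_inf_iterClosure_soc h (hcmp h)
  dsimp only at *
  refine ⟨y, ⟨hay, hyb⟩, by rw [inf_comm, hsy], by rw [sup_comm, hsy'],
    -- Including `y` itself keeps the supremum above `y` even when `X` is empty.
    hyb, insert y ((y ⊔ ·) '' X), ?_, ?_, ?_⟩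
  · rintro _ (rfl | ⟨x, hx, rfl⟩)
    · exact ⟨le_rfl, hyb⟩
    · exact ⟨le_sup_left, sup_le hyb ((hX hx).2.trans inf_le_left)⟩
  · refine le_antisymm (sSup_le ?_) ?_
    · rintro _ (rfl | ⟨x, hx, rfl⟩)
      · exact hyb
      · exact sup_le hyb ((hX hx).2.trans inf_le_left)
    · rw [← hsy', ← hXs]
      refine sup_le (sSup_le fun x hx => ?_) (le_sSup (Set.mem_insert _ _))
      exact le_sup_right.trans (le_sSup (Set.mem_insert_of_mem _ ⟨x, hx, rfl⟩))
  · rintro _ (rfl | ⟨x, hx, rfl⟩)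
    · exact (isBasic_crt hj').refl_mem _
    · exact (isBasic_crt hj').sup_mem hay (smp_subset_crt hj' (hXsmp x hx))
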